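/- \textbf{Non-degenerate critical points are isolated.} \emph{Notation.} Let $d\in\mathbb N$. For $A\subset\mathbb R^d$ let $d_A$ be the distance function of $A$, let $\complement A:=\overline{\mathbb R^d\setminus A}$, and let $\operatorname{Tan}(A,x)$ be the tangent cone of $A$ at $x$: the set of all limits $\lim_i c_i(x_i-x)$ with $c_i\ge 0$, $x_i\in A$, $x_i\to x$ (so $0\in \operatorname{Tan}(A,x)$ for $x\in A$). Write $B^{\mathrm o}=\{u:\langle u,b\rangle\le 0\ \forall b\in B\}$. The \emph{reach} of $A$ is the largest $t\in[0,\infty]$ such that every $x$ with $d_A(x)<t$ has a unique closest point in $A$. For $\mu\in(0,1]$, $\operatorname{reach}_\mu(A)$ is the supremum of the $s\ge 0$ such that every element of the Clarke gradient of $d_A$ at $x$ has norm at least $\mu$ whenever $0<d_A(x)\le s$; here the Clarke gradient of a locally Lipschitz function $\varphi$ at $x$ is the convex hull of the limits $\lim_i\nabla\varphi(x_i)$, where $x_i\to x$ and $\varphi$ is differentiable at each $x_i$. A compact set $X\subset\mathbb R^d$ is \emph{complementary regular} if $\overline{\operatorname{int}X}=X$, $\operatorname{reach}_\mu(X)>0$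 for some $\mu\in(0,1]$, and $\operatorname{reach}(\complement X)>0$. Let $X\subset\mathbb R^d$ have positive reach or be complementary regular. For $x\in X$ put $\operatorname{Nor}(X,x):=\operatorname{Tan}(X,x)^{\mathrm o}$ if $X$ has positive reach; otherwise put $\operatorname{Nor}(X,x):=-\operatorname{Tan}(\complement X,x)^{\mathrm o}$ for $x\in\partial X$ and $\operatorname{Nor}(X,x):=\{0\}$ for $x\in\operatorname{int}X$. The normal bundle is $\operatorname{Nor}(X):=\{(x,n): x\in\partial X,\ n\in\operatorname{Nor}(X,x),\ \|n\|=1\}$. A pair $(x,n)\in\operatorname{Nor}(X)$ is \emph{regular} if $T_{x,n}:=\operatorname{Tan}(\operatorname{Nor}(X),(x,n))$ is a vector space of dimension $d-1$. In that case, with $\pi_0(u,v):=u$, the second fundamental form of $X$ at $(x,n)$ is the bilinear form on $\pi_0(T_{x,n})$ given by $\mathrm{II}_{x,n}(u,u'):=\langle u,v'\rangle$ for $(u,v),(u',v')\in T_{x,n}$. Let $f:\mathbb R^d\to\mathbb R$ be of class $C^2$. A point $x\in X$ is a \emph{critical point} of $f_{|X}$ if $-\nabla f(x)\in\operatorname{Nor}(X,x)$.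 It is \emph{non-degenerate} if moreover $\nabla f(x)\ne 0$, the pair $(x,n)$ with $n:=-\nabla f(x)/\|\nabla f(x)\|$ is regular, and the bilinear form $$H_xf_{|X}(u,u'):=H_xf(u,u')+\|\nabla f(x)\|\,\mathrm{II}_{x,n}(u,u')$$ on $\pi_0(T_{x,n})$ is non-degenerate, where $H_xf$ is the Hessian of $f$ at $x$. \emph{Statement.} Let $X\subset\mathbb R^d$ be a set of positive reach or a complementary regular set, and let $f:\mathbb R^d\to\mathbb R$ be of class $C^2$. Then every non-degenerate critical point $x$ of $f_{|X}$ is isolated in the set of critical points of $f_{|X}$: there is a neighbourhood $U$ of $x$ such that $x$ is the only critical point of $f_{|X}$ in $U$. -/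

import Mathlib

open Set Filter Topology
open scoped ENNReal Pointwise RealInnerProductSpace

namespace MorseReach

noncomputable section

/-- Euclidean space `ℝᵈ`. -/
abbrev E (d : ℕ) : Type := EuclideanSpace ℝ (Fin d)

/-! ### Distance functions, reach and `μ`-reach -/

/-- The complement set: the closure of the set-theoretic complement. -/
def complSet {d : ℕ} (X : Set (E d)) : Set (E d) := closure Xᶜ

/-- The reach of `X`: the largest `t` such that every point at distance `< t` from `X` has a unique
closest point in `X`. -/
def reach {d : ℕ} (X : Set (E d)) : ℝ≥0∞ :=
  sSup {t : ℝ≥0∞ | ∀ x : E d, Metric.infEDist x X < t →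
    ∃! z : E d, z ∈ X ∧ edist x z = Metric.infEDist x X}

/-- The Clarke gradient of `φ` at `x`: the convex hull of all limits of `∇φ(xᵢ)`, where `xᵢ → x` and
`φ` is differentiable at every `xᵢ`. -/
def clarkeGradient {d : ℕ} (φ : E d → ℝ) (x : E d) : Set (E d) :=
  convexHull ℝ {g : E d | ∃ y : ℕ → E d, Tendsto y atTop (𝓝 x) ∧
    (∀ i, DifferentiableAt ℝ φ (y i)) ∧ Tendsto (fun i => gradient φ (y i)) atTop (𝓝 g)}

/-- `Δ(A) = inf {‖a‖ : a ∈ A}`, the distance from the origin to `A`. -/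
def minNorm {d : ℕ} (A : Set (E d)) : ℝ := Metric.infDist 0 A

/-- The `μ`-reach of `X`: the supremum of the `s ≥ 0` such that `Δ(∂d_X(x)) ≥ μ` at every point `x`
outside the closure of `X` with `d_X(x) ≤ s`. -/
def muReach {d : ℕ} (μ : ℝ) (X : Set (E d)) : ℝ≥0∞ :=
  sSup {t : ℝ≥0∞ | ∃ s : ℝ, 0 ≤ s ∧ t = ENNReal.ofReal s ∧
    ∀ x : E d, 0 < Metric.infDist x X → Metric.infDist x X ≤ s →
      μ ≤ minNorm (clarkeGradient (fun y => Metric.infDist y X) x)}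

/-- Complementary regular sets. -/
structure IsComplementaryRegular {d : ℕ} (X : Set (E d)) : Prop where
  isCompact : IsCompact X
  closure_interior : closure (interior X) = X
  muReach_pos : ∃ μ : ℝ, 0 < μ ∧ μ ≤ 1 ∧ 0 < muReach μ X
  reach_compl_pos : 0 < reach (complSet X)

/-! ### Normal cones and normal bundles -/

/-- The polar cone `{u : ⟪u, b⟫ ≤ 0 for all b ∈ B}`. -/
def polarCone {d : ℕ} (B : Set (E d)) : Set (E d) := {u | ∀ b ∈ B, ⟪u, b⟫ ≤ 0}

/-- The normal cone `Nor(X, x)` at a point `x ∈ X`: the polar of the tangent cone of `X` at `x` if `X`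
has positive reach; otherwise the opposite of the normal cone at `x` of the complement set, which
is `{0}` at points of the interior of `X`, where the complement set is absent.
Mathlib's `posTangentConeAt` is the cone of the limits of `cᵢ • (xᵢ - x)`, `xᵢ ∈ X`, `xᵢ → x`,
`cᵢ ≥ 0`. -/
def normalCone {d : ℕ} (X : Set (E d)) (x : E d) : Set (E d) :=
  open scoped Classical in
  if 0 < reach X then polarCone (posTangentConeAt X x)
  else if x ∈ interior X then {0}
  else -polarCone (posTangentConeAt (complSet X) x)

/-- The (unit) normal bundle `Nor(X) ⊆ ℝᵈ × 𝕊ᵈ⁻¹`. -/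
def normalBundle {d : ℕ} (X : Set (E d)) : Set (E d × E d) :=
  {p | p.1 ∈ frontier X ∧ p.2 ∈ normalCone X p.1 ∧ ‖p.2‖ = 1}

/-- The linear span of the tangent cone `Tan(Nor(X), p)`; at a regular pair `p` it is that cone
itself. -/
def bundleTangent {d : ℕ} (X : Set (E d)) (p : E d × E d) : Submodule ℝ (E d × E d) :=
  Submodule.span ℝ (posTangentConeAt (normalBundle X) p)

/-- A pair `p ∈ Nor(X)` is regular when `Tan(Nor(X), p)` is a vector space of dimension `d - 1`. -/
structure IsRegularPair {d : ℕ} (X : Set (E d)) (p : E d × E d) : Prop where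
  mem : p ∈ normalBundle X
  coe_eq : (bundleTangent X p : Set (E d × E d)) = posTangentConeAt (normalBundle X) p
  finrank_add_one : Module.finrank ℝ (bundleTangent X p) + 1 = d

/-! ### Second fundamental form, Hessian, critical points -/

/-- The projection `π₀(V) ⊆ ℝᵈ` of `V ⊆ ℝᵈ × ℝᵈ` onto the first factor. -/
def baseSpace {d : ℕ} (V : Submodule ℝ (E d × E d)) : Submodule ℝ (E d) :=
  V.map (LinearMap.fst ℝ (E d) (E d))

theorem exists_lift {d : ℕ} (V : Submodule ℝ (E d × E d)) :
    ∃ s : baseSpace V →ₗ[ℝ] E d, ∀ u : baseSpace V, ((u : E d), s u) ∈ V := by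
  let g : V →ₗ[ℝ] baseSpace V := (LinearMap.fst ℝ (E d) (E d)).submoduleMap V
  obtain ⟨t, ht⟩ := g.exists_rightInverse_of_surjective
    (LinearMap.range_eq_top.2 ((LinearMap.fst ℝ (E d) (E d)).submoduleMap_surjective V))
  refine ⟨LinearMap.snd ℝ (E d) (E d) ∘ₗ V.subtype ∘ₗ t, fun u => ?_⟩
  have h1 : ((t u : V) : E d × E d).1 = (u : E d) :=
    congrArg Subtype.val (LinearMap.congr_fun ht u)
  have h2 : ((u : E d), ((t u : V) : E d × E d).2) = ((t u : V) : E d × E d) := by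
    rw [← h1]
  simp [h2]

/-- A linear choice, for `u ∈ π₀(V)`, of a vector `v` with `(u, v) ∈ V`. -/
def lift {d : ℕ} (V : Submodule ℝ (E d × E d)) : baseSpace V →ₗ[ℝ] E d :=
  (exists_lift V).choose

theorem lift_mem {d : ℕ} (V : Submodule ℝ (E d × E d)) (u : baseSpace V) :
    ((u : E d), lift V u) ∈ V := (exists_lift V).choose_spec u

/-- The form `(u, u') ↦ ⟪u, v'⟫` on `π₀(V)`, where `(u', v') ∈ V`. -/
def pairingForm {d : ℕ} (V : Submodule ℝ (E d × E d)) : LinearMap.BilinForm ℝ (baseSpace V) :=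
  (innerₗ (E d)).compl₁₂ (baseSpace V).subtype (lift V)

/-- As soon as `⟪u, v'⟫` depends only on `u` and `u'`, it is the value of the form,
whatever the choice of `v'`. -/
theorem pairingForm_apply {d : ℕ} (V : Submodule ℝ (E d × E d))
    (h : ∀ w : E d, ((0 : E d), w) ∈ V → ∀ u ∈ baseSpace V, ⟪u, w⟫ = 0)
    (u u' : baseSpace V) (v' : E d) (hv : ((u' : E d), v') ∈ V) :
    pairingForm V u u' = ⟪(u : E d), v'⟫ := by
  have h0 : ((0 : E d), lift V u' - v') ∈ V := by
    simpa using V.sub_mem (lift_mem V u') hv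
  have h1 := h _ h0 u u.2
  rw [inner_sub_right] at h1
  simpa [pairingForm] using sub_eq_zero.1 h1

/-- The second fundamental form of `X` at the (regular) pair `p`, on `π₀(Tan(Nor(X), p))`. -/
def secondFundamentalForm {d : ℕ} (X : Set (E d)) (p : E d × E d) :
    LinearMap.BilinForm ℝ (baseSpace (bundleTangent X p)) :=
  pairingForm (bundleTangent X p)

/-- The second derivative `H_x f` as a bilinear form. -/
def hessian {d : ℕ} (f : E d → ℝ) (x : E d) : LinearMap.BilinForm ℝ (E d) :=
  ContinuousLinearMap.toLinearMap₁₂ (fderiv ℝ (fderiv ℝ f) x)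

/-- `n = -∇f(x) / ‖∇f(x)‖`. -/
def unitNormal {d : ℕ} (f : E d → ℝ) (x : E d) : E d := -(‖gradient f x‖⁻¹ • gradient f x)

/-- The Hessian of `f|_X` at `x`: the form `H_x f + ‖∇f(x)‖ II_{x,n}` on `π₀(Tan(Nor(X), (x, n)))`. -/
def restrictedHessian {d : ℕ} (f : E d → ℝ) (X : Set (E d)) (x : E d) :
    LinearMap.BilinForm ℝ (baseSpace (bundleTangent X (x, unitNormal f x))) :=
  (hessian f x).restrict _ + ‖gradient f x‖ • secondFundamentalForm X (x, unitNormal f x)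

/-- `x` is a critical point of `f|_X`. -/
def IsCriticalPoint {d : ℕ} (f : E d → ℝ) (X : Set (E d)) (x : E d) : Prop :=
  x ∈ X ∧ gradient f x ∈ -normalCone X x

/-- `x` is a non-degenerate critical point of `f|_X`. -/
structure IsNondegenerateCriticalPoint {d : ℕ} (f : E d → ℝ) (X : Set (E d)) (x : E d) : Prop where
  isCriticalPoint : IsCriticalPoint f X x
  gradient_ne_zero : gradient f x ≠ 0
  isRegularPair : IsRegularPair X (x, unitNormal f x)
  nondegenerate : (restrictedHessian f X x).Nondegenerate

end

end MorseReach

/-! Suppose critical points `y ≠ x` accumulate at `x`. Near `x` the gradient is nonzero, so `y ↦ (y,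
n(y))`, with `n = -∇f / ‖∇f‖`, maps critical points into `Nor(X)`. It is differentiable at `x`, so
some `u ≠ 0` satisfies `(u, Dn u) ∈ T`, the tangent space of `Nor(X)` at `(x, n)`. For `u' ∈ π₀(T)`
one has `u' ⟂ n`, hence `‖∇f‖ ⟪u', Dn u⟫ = -H f (u', u)`, while `II (u', u) = ⟪u', Dn u⟫`. So `u`
lies in the kernel of the restricted Hessian, a contradiction.

Two facts about `T` are needed: `π₀(T) ⟂ n`, and vertical vectors `(0, w) ∈ T` satisfy `w ⟂ π₀(T)`,
so that `II` does not depend on lifts. Both follow from the one-sided bound `σ ⟪y - x, n⟫ ≤ K ‖y -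
x‖ ^ 2` on `Nor(X)` (`exists_inner_le_of_mem_normalBundle`), with `σ = 1` for positive reach and `σ
= -1` when the complement has positive reach.

That bound is Federer's: if projections are unique in a tube of radius `r`, a segment leaving its
closest point extends inside the tube with the same closest point (`HasUniqueProj.infDist_ray`).
This gives empty balls touching `X`, and polar vectors are limits of such projection directions. -/

namespace MorseReach

/-! ### Sets with unique projections in a tube -/

section UniqueProjection

/-- Every point at distance `< r` from `X` has a unique closest point in `X`. -/
def HasUniqueProj {V : Type*} [PseudoMetricSpace V] (X : Set V) (r : ℝ) : Prop :=
  ∀ x : V, Metric.infDist x X < r → ∃! z : V, z ∈ X ∧ dist x z = Metric.infDist x X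

theorem HasUniqueProj.isClosed {V : Type*} [MetricSpace V] {X : Set V} {r : ℝ}
    (h : HasUniqueProj X r) (hr : 0 < r)
    (hne : X.Nonempty) : IsClosed X := by
  refine isClosed_of_closure_subset fun x hx => ?_
  have h0 := (Metric.mem_closure_iff_infDist_zero hne).1 hx
  obtain ⟨z, ⟨hz, hd⟩, -⟩ := h x (by rw [h0]; exact hr)
  rw [h0, dist_eq_zero] at hd
  exact hd ▸ hz

variable {V : Type*} [NormedAddCommGroup V] [InnerProductSpace ℝ V]

/-- If the distance to `X` does not increase from `z` in the direction `h`, then `h` makes an angle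
at least `π / 2` with the direction from the closest point `p` to `z`. -/
theorem inner_sub_nonpos_of_infDist_le [ProperSpace V] {X : Set V} (hX : IsClosed X) {z p h : V}
    (hp : p ∈ X) (huniq : ∀ q ∈ X, dist z q = Metric.infDist z X → q = p)
    (hle : ∀ t ∈ Ioc (0 : ℝ) 1, Metric.infDist (z + t • h) X ≤ Metric.infDist z X) :
    ⟪h, z - p⟫ ≤ 0 := by
  have hproj : ∀ t : ℝ, ∃ q ∈ X, Metric.infDist (z + t • h) X = dist (z + t • h) q :=
    fun t => hX.exists_infDist_eq_dist ⟨p, hp⟩ _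
  choose q hqX hq using hproj
  -- An ultrafilter refining `t → 0⁺` replaces the extraction of a convergent subsequence from the
  -- bounded projections `q t`.
  let l : Ultrafilter ℝ := Ultrafilter.of (𝓝[>] (0 : ℝ))
  have hl : (l : Filter ℝ) ≤ 𝓝[>] (0 : ℝ) := Ultrafilter.of_le _
  have hl1 : ∀ᶠ t in (l : Filter ℝ), t ∈ Ioc (0 : ℝ) 1 := hl (Ioc_mem_nhdsGT one_pos)
  have ht0 : Tendsto (fun t : ℝ => t) l (𝓝 0) := hl.trans nhdsWithin_le_nhds
  have hzt : Tendsto (fun t : ℝ => z + t • h) l (𝓝 z) := by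
    have := (tendsto_const_nhds (x := z)).add (ht0.smul_const h)
    rwa [zero_smul, add_zero] at this
  have hbd : ∀ᶠ t in (l : Filter ℝ),
      q t ∈ Metric.closedBall z (‖h‖ + Metric.infDist z X) := by
    filter_upwards [hl1] with t ht
    rw [Metric.mem_closedBall]
    have h1 : dist (q t) z ≤ dist (z + t • h) z + dist (z + t • h) (q t) := by
      rw [dist_comm (q t) z, dist_comm (z + t • h) z]
      exact dist_triangle _ _ _
    have h2 : dist (z + t • h) z ≤ ‖h‖ := by
      rw [dist_eq_norm, add_sub_cancel_left, norm_smul, Real.norm_of_nonneg ht.1.le]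
      exact mul_le_of_le_one_left (norm_nonneg _) ht.2
    have h3 := hle t ht
    rw [hq t] at h3
    linarith
  obtain ⟨q₀, -, hq₀⟩ := (isCompact_closedBall z _).ultrafilter_le_nhds' (l.map q) hbd
  have hq₀ : Tendsto q l (𝓝 q₀) := hq₀
  have hq₀X : q₀ ∈ X := hX.mem_of_tendsto hq₀ (Eventually.of_forall hqX)
  have hlim1 : Tendsto (fun t : ℝ => Metric.infDist (z + t • h) X) l (𝓝 (Metric.infDist z X)) := by
    have := (Metric.continuous_infDist_pt X).tendsto z |>.comp hzt
    exact this
  have hlim2 : Tendsto (fun t : ℝ => Metric.infDist (z + t • h) X) l (𝓝 (dist z q₀)) := by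
    simp_rw [hq]
    exact hzt.dist hq₀
  have hq₀p : q₀ = p := huniq q₀ hq₀X (tendsto_nhds_unique hlim2 hlim1)
  rw [hq₀p] at hq₀
  have hlim : Tendsto (fun t => ⟪h, z - q t⟫) l (𝓝 ⟪h, z - p⟫) :=
    tendsto_const_nhds.inner (tendsto_const_nhds.sub hq₀)
  refine le_of_tendsto hlim ?_
  filter_upwards [hl1] with t ht
  -- Comparing both distances to the same point `q t` and expanding the square gives `t² ‖h‖² + 2 t
  -- ⟪h, z - q t⟫ ≤ 0`.
  have h1 : ‖z + t • h - q t‖ ≤ ‖z - q t‖ := by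
    rw [← dist_eq_norm, ← hq t, ← dist_eq_norm]
    exact (hle t ht).trans (Metric.infDist_le_dist_of_mem (hqX t))
  have h2 : ‖z + t • h - q t‖ ^ 2 = t ^ 2 * ‖h‖ ^ 2 + 2 * (t * ⟪h, z - q t⟫) + ‖z - q t‖ ^ 2 := by
    rw [show z + t • h - q t = t • h + (z - q t) by abel, norm_add_sq_real, inner_smul_left,
      norm_smul, mul_pow, Real.norm_eq_abs, sq_abs]
    simp
  have h3 : ‖z + t • h - q t‖ ^ 2 ≤ ‖z - q t‖ ^ 2 := by gcongr
  by_contra! hcon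
  have h4 : 0 < t * ⟪h, z - q t⟫ := mul_pos ht.1 hcon
  nlinarith [mul_nonneg (sq_nonneg t) (sq_nonneg ‖h‖)]

/-- The segment from a closest point `a` to `z` may be extended a little beyond `z`. -/
theorem HasUniqueProj.infDist_extend [ProperSpace V] {X : Set V} {r : ℝ} (hX : HasUniqueProj X r)
    {a n : V} (ha : a ∈ X) (hn : ‖n‖ = 1) {t ε : ℝ} (hε : 0 < ε) (hεt : ε < t)
    (htr : t + ε < r) (hd : Metric.infDist (a + t • n) X = t) :
    Metric.infDist (a + (t + ε) • n) X = t + ε := by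
  have hcl := hX.isClosed (by linarith) ⟨a, ha⟩
  set z₀ := a + t • n with hz₀
  -- Let `z` be a farthest point from `X` in a small ball around `z₀`, with projection `p`.
  -- First-order optimality makes `z` extremal in the ball in direction `z - p`, so `p`, `z₀`, `z`
  -- are aligned. Then `p` is also closest to `z₀`, and uniqueness gives `p = a`.
  obtain ⟨z, hz, hmax⟩ := (isCompact_closedBall z₀ ε).exists_isMaxOn
    ⟨z₀, Metric.mem_closedBall_self hε.le⟩ (Metric.continuous_infDist_pt X).continuousOn
  have hmax : ∀ y ∈ Metric.closedBall z₀ ε, Metric.infDist y X ≤ Metric.infDist z X := hmax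
  have hzε : ‖z - z₀‖ ≤ ε := by simpa [dist_eq_norm] using hz
  have hzt : t ≤ Metric.infDist z X := hd ▸ hmax z₀ (Metric.mem_closedBall_self hε.le)
  have hzle : Metric.infDist z X ≤ t + ε := by
    have := Metric.infDist_le_infDist_add_dist (s := X) (x := z) (y := z₀)
    rw [hd, dist_eq_norm] at this
    linarith
  obtain ⟨p, ⟨hp, hpd⟩, hpu⟩ := hX z (by linarith)
  set w := z - p with hw
  have hwn : ‖w‖ = Metric.infDist z X := by rw [← hpd, dist_eq_norm]
  have hwpos : 0 < ‖w‖ := by linarith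
  have hin : ∀ y ∈ Metric.closedBall z₀ ε, ⟪y - z, w⟫ ≤ 0 := fun y hy =>
    inner_sub_nonpos_of_infDist_le hcl hp (fun q hq hqd => hpu q ⟨hq, hqd⟩) fun s hs =>
      hmax _ <| (convex_closedBall z₀ ε).add_smul_sub_mem hz hy ⟨hs.1.le, hs.2⟩
  have h1 : ε * ‖w‖ ≤ ⟪z - z₀, w⟫ := by
    have hy := hin (z₀ + (ε / ‖w‖) • w) (by
      rw [Metric.mem_closedBall, dist_eq_norm, add_sub_cancel_left, norm_smul, norm_div, norm_norm,
        div_mul_cancel₀ _ hwpos.ne', Real.norm_of_nonneg hε.le])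
    rw [show z₀ + (ε / ‖w‖) • w - z = (ε / ‖w‖) • w - (z - z₀) by abel, inner_sub_left,
      real_inner_smul_left, real_inner_self_eq_norm_sq] at hy
    have : ε / ‖w‖ * ‖w‖ ^ 2 = ε * ‖w‖ := by field_simp
    linarith
  -- Equality case of Cauchy–Schwarz: `‖z - z₀‖ ≤ ε` but `⟪z - z₀, w⟫ ≥ ε ‖w‖`.
  have h2 : z - z₀ = (ε / ‖w‖) • w := by
    rw [← sub_eq_zero, ← norm_eq_zero, ← sq_eq_zero_iff]
    refine le_antisymm ?_ (sq_nonneg _)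
    rw [norm_sub_sq_real, inner_smul_right, norm_smul, norm_div, norm_norm,
      div_mul_cancel₀ _ hwpos.ne', Real.norm_of_nonneg hε.le]
    have h3 : ε / ‖w‖ * (ε * ‖w‖) ≤ ε / ‖w‖ * ⟪z - z₀, w⟫ := by gcongr
    have h4 : ε / ‖w‖ * (ε * ‖w‖) = ε ^ 2 := by field_simp
    nlinarith [norm_nonneg (z - z₀)]
  have h3 : z₀ - p = (1 - ε / ‖w‖) • w := by
    rw [sub_smul, one_smul, ← h2, hw]; abel
  have h4 : ‖z₀ - p‖ = ‖w‖ - ε := by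
    rw [h3, norm_smul, Real.norm_of_nonneg (by rw [sub_nonneg, div_le_one hwpos]; linarith)]
    field_simp
  have h5 : t ≤ ‖z₀ - p‖ := by
    rw [← hd, ← dist_eq_norm]; exact Metric.infDist_le_dist_of_mem hp
  have h6 : ‖w‖ = t + ε := by linarith
  have h7 : p = a := by
    refine (hX z₀ (by rw [hd]; linarith)).unique ⟨hp, ?_⟩ ⟨ha, ?_⟩
    · rw [hd, dist_eq_norm, h4, h6]; ring
    · rw [hd, dist_eq_norm, hz₀, add_sub_cancel_left, norm_smul, hn,
        Real.norm_of_nonneg (by linarith), mul_one]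
  have h8 : t • n = (t / (t + ε)) • w := by
    have h9 : z₀ - a = t • n := by rw [hz₀]; abel
    rw [← h9, ← h7, h3, h6]
    congr 1
    have : t + ε ≠ 0 := by linarith
    field_simp
    ring
  have h9 : a + (t + ε) • n = z := by
    have h10 : w = (t + ε) • n := by
      have h11 : ((t + ε) / t) • t • n = ((t + ε) / t) • (t / (t + ε)) • w := by rw [h8]
      have e1 : t ≠ 0 := by linarith
      have e2 : t + ε ≠ 0 := by linarith
      rw [smul_smul, smul_smul, div_mul_cancel₀ _ e1, div_mul_div_cancel₀ e1, div_self e2,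
        one_smul] at h11
      exact h11.symm
    rw [← h10, hw, h7]; abel
  rw [h9, ← hwn, h6]

/-- The segment from a closest point `a` to `z` may be extended up to the length `r`. -/
theorem HasUniqueProj.infDist_ray [ProperSpace V] {X : Set V} {r : ℝ} (hX : HasUniqueProj X r)
    {a n : V} (ha : a ∈ X) (hn : ‖n‖ = 1) {t s : ℝ} (ht : 0 < t) (hts : t ≤ s) (hsr : s < r)
    (hd : Metric.infDist (a + t • n) X = t) : Metric.infDist (a + s • n) X = s := by
  have hcl : IsClosed {τ : ℝ | Metric.infDist (a + τ • n) X = τ} :=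
    isClosed_eq ((Metric.continuous_infDist_pt X).comp (by fun_prop)) continuous_id
  -- Continuous induction: the good lengths form a closed set, and each one below `s` can be
  -- increased. The cap `τ / 2` on the increment ensures `ε < τ`, as the extension requires.
  refine (hcl.inter isClosed_Icc).Icc_subset_of_forall_exists_gt (a := t) (b := s) hd
    (fun τ hτ y hy => ?_) ⟨hts, le_rfl⟩
  have hy : τ < y := hy
  obtain ⟨hτd, hτt, hτs⟩ := hτ
  set ε := min (min (y - τ) (s - τ)) (τ / 2) with hε
  have hε0 : 0 < ε := lt_min (lt_min (by linarith) (by linarith)) (by linarith)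
  have hε1 : ε ≤ y - τ := (min_le_left _ _).trans (min_le_left _ _)
  have hε2 : ε ≤ s - τ := (min_le_left _ _).trans (min_le_right _ _)
  have hε3 : ε ≤ τ / 2 := min_le_right _ _
  exact ⟨τ + ε, hX.infDist_extend ha hn hε0 (by linarith) (by linarith) hτd, by linarith,
    by linarith⟩

/-- Prolong the segment from `q` through `z` to length `r / 2`, which is safely below `r`. The open
ball of radius `r / 2` about its end misses `X`; expanding the square of the distance from `y` to
this centre gives the bound. -/
theorem HasUniqueProj.inner_le_of_proj [ProperSpace V] {X : Set V} {r : ℝ}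
    (hX : HasUniqueProj X r) {z q y : V} (hq : q ∈ X) (hqd : dist z q = Metric.infDist z X)
    (hz : Metric.infDist z X ≤ r / 2) (hy : y ∈ X) :
    ⟪y - q, z - q⟫ ≤ ‖z - q‖ * ‖y - q‖ ^ 2 / r := by
  rcases eq_or_ne z q with rfl | hne
  · simp
  have hpos : 0 < ‖z - q‖ := norm_pos_iff.2 (sub_ne_zero.2 hne)
  rw [← hqd, dist_eq_norm] at hz
  set t := ‖z - q‖ with ht
  set n := t⁻¹ • (z - q) with hn
  have hn1 : ‖n‖ = 1 := by
    rw [hn, norm_smul, norm_inv, Real.norm_of_nonneg hpos.le, ← ht, inv_mul_cancel₀ hpos.ne']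
  have htn : t • n = z - q := by rw [hn, smul_inv_smul₀ hpos.ne']
  have hray := hX.infDist_ray hq hn1 hpos hz (by linarith)
    (by rw [htn, add_sub_cancel, ← hqd, dist_eq_norm])
  have hle : r / 2 ≤ ‖q + (r / 2) • n - y‖ := by
    rw [← dist_eq_norm]
    exact hray.symm.le.trans (Metric.infDist_le_dist_of_mem hy)
  have hsq : (r / 2) ^ 2 ≤ ‖q + (r / 2) • n - y‖ ^ 2 := by
    have : 0 ≤ r / 2 := by linarith
    gcongr
  rw [show q + (r / 2) • n - y = (r / 2) • n - (y - q) by abel, norm_sub_sq_real, norm_smul, hn1,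
    real_inner_smul_left, mul_one, Real.norm_of_nonneg (by linarith), real_inner_comm] at hsq
  rw [← htn, real_inner_smul_right, mul_div_assoc]
  gcongr
  rw [le_div_iff₀ (by linarith)]
  linarith

/-- Normal vectors, defined as polar to the tangent cone, are proximal normals with a uniform
radius. -/
theorem HasUniqueProj.inner_le_of_polar [ProperSpace V] {X : Set V} {r : ℝ} (hr : 0 < r)
    (hX : HasUniqueProj X r) {x n y : V} (hx : x ∈ X) (hn : ‖n‖ = 1)
    (hpol : ∀ b ∈ posTangentConeAt X x, ⟪n, b⟫ ≤ 0) (hy : y ∈ X) :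
    ⟪y - x, n⟫ ≤ ‖y - x‖ ^ 2 / r := by
  have hcl := hX.isClosed hr ⟨x, hx⟩
  have hproj : ∀ t : ℝ, ∃ q ∈ X, Metric.infDist (x + t • n) X = dist (x + t • n) q :=
    fun t => hcl.exists_infDist_eq_dist ⟨x, hx⟩ _
  choose q hqX hq using hproj
  let l : Ultrafilter ℝ := Ultrafilter.of (𝓝[>] (0 : ℝ))
  have hl : (l : Filter ℝ) ≤ 𝓝[>] (0 : ℝ) := Ultrafilter.of_le _
  have hl1 : ∀ᶠ t in (l : Filter ℝ), t ∈ Ioc (0 : ℝ) (r / 2) := hl (Ioc_mem_nhdsGT (by linarith))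
  have ht0 : Tendsto (fun t : ℝ => t) l (𝓝 0) := hl.trans nhdsWithin_le_nhds
  have hdt : ∀ t ∈ Ioc (0 : ℝ) (r / 2), dist (x + t • n) (q t) ≤ t := fun t ht => by
    rw [← hq t]
    refine (Metric.infDist_le_dist_of_mem hx).trans ?_
    rw [dist_eq_norm, add_sub_cancel_left, norm_smul, hn, mul_one, Real.norm_of_nonneg ht.1.le]
  have hsplit : ∀ t ∈ Ioc (0 : ℝ) (r / 2),
      n - t⁻¹ • (q t - x) = t⁻¹ • (x + t • n - q t) := fun t ht => by
    rw [show x + t • n - q t = t • n - (q t - x) by abel, smul_sub t⁻¹ (t • n),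
      inv_smul_smul₀ ht.1.ne']
  have hnorm : ∀ t ∈ Ioc (0 : ℝ) (r / 2), ‖n - t⁻¹ • (q t - x)‖ ≤ 1 := fun t ht => by
    rw [hsplit t ht, norm_smul, norm_inv, Real.norm_of_nonneg ht.1.le, ← dist_eq_norm,
      inv_mul_le_one₀ ht.1]
    exact hdt t ht
  have hbd : ∀ᶠ t in (l : Filter ℝ), t⁻¹ • (q t - x) ∈ Metric.closedBall n 1 := by
    filter_upwards [hl1] with t ht
    rw [Metric.mem_closedBall, dist_comm, dist_eq_norm]
    exact hnorm t ht
  obtain ⟨τ, -, hτ⟩ :=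
    (isCompact_closedBall n 1).ultrafilter_le_nhds' (l.map fun t => t⁻¹ • (q t - x)) hbd
  have hτ : Tendsto (fun t => t⁻¹ • (q t - x)) l (𝓝 τ) := hτ
  have hq0 : Tendsto (fun t => q t - x) l (𝓝 0) := by
    have := ht0.smul hτ
    rw [zero_smul] at this
    refine this.congr' ?_
    filter_upwards [hl1] with t ht
    rw [smul_inv_smul₀ ht.1.ne']
  have hτmem : τ ∈ posTangentConeAt X x := by
    refine mem_tangentConeAt_of_seq (l : Filter ℝ) (fun t => (t⁻¹).toNNReal) (fun t => q t - x) hq0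
      (Eventually.of_forall fun t => by simpa using hqX t) (hτ.congr' ?_)
    filter_upwards [hl1] with t ht
    rw [NNReal.smul_def, Real.coe_toNNReal _ (inv_nonneg.2 ht.1.le)]
  -- The limit `τ` of `(q t - x) / t` is tangent, so `⟪n, τ⟫ ≤ 0`. Since `x` competes with `q t`,
  -- also `‖n - τ‖ ≤ 1 = ‖n‖`; together these force `τ = 0`. Hence the rescaled projection
  -- directions tend to `n`, and the bound for projections passes to the limit.
  have hτ0 : τ = 0 := by
    have h1 : ‖n - τ‖ ≤ 1 := by
      refine le_of_tendsto (tendsto_const_nhds.sub hτ).norm ?_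
      filter_upwards [hl1] with t ht using hnorm t ht
    have h2 := hpol τ hτmem
    have h3 : ‖n - τ‖ ^ 2 ≤ 1 := pow_le_one₀ (norm_nonneg _) h1
    rw [norm_sub_sq_real, hn] at h3
    have h4 : ‖τ‖ ^ 2 = 0 := le_antisymm (by linarith) (sq_nonneg _)
    exact norm_eq_zero.1 (pow_eq_zero_iff two_ne_zero |>.1 h4)
  rw [hτ0] at hτ
  have hν : Tendsto (fun t => n - t⁻¹ • (q t - x)) l (𝓝 n) := by
    simpa using tendsto_const_nhds.sub hτ
  have hyq : Tendsto (fun t => y - q t) l (𝓝 (y - x)) := by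
    have := (tendsto_const_nhds (x := y - x)).sub hq0
    simpa using this
  have hL := hyq.inner hν (𝕜 := ℝ)
  have hR := (hν.norm.mul (hyq.norm.pow 2)).div_const r
  rw [hn, one_mul] at hR
  refine le_of_tendsto_of_tendsto hL hR ?_
  filter_upwards [hl1] with t ht
  have hz : Metric.infDist (x + t • n) X ≤ r / 2 := by
    rw [hq t]; exact (hdt t ht).trans ht.2
  have h1 := hX.inner_le_of_proj (hqX t) (hq t).symm hz hy
  have ht' : 0 < t⁻¹ := inv_pos.2 ht.1
  simp only [hsplit t ht, real_inner_smul_right, norm_smul, Real.norm_of_nonneg ht'.le]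
  rw [mul_assoc, mul_div_assoc]
  gcongr

end UniqueProjection

/-! ### Normal bundles -/

section NormalBundle

variable {d : ℕ} {X : Set (E d)}

theorem exists_hasUniqueProj_of_reach_pos (h : 0 < reach X) (hne : X.Nonempty) :
    ∃ r : ℝ, 0 < r ∧ HasUniqueProj X r := by
  obtain ⟨t, ht, ht0⟩ := lt_sSup_iff.1 h
  obtain ⟨r, hr0, hrt⟩ := ENNReal.lt_iff_exists_real_btwn.1 ht0 |>.imp fun r hr => hr.2
  have hr0 : 0 < r := by simpa using hr0
  refine ⟨r, hr0, fun x hx => ?_⟩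
  have hfin : Metric.infEDist x X ≠ ⊤ := Metric.infEDist_ne_top hne
  have key : ∀ z : E d, edist x z = Metric.infEDist x X ↔ dist x z = Metric.infDist x X := by
    intro z
    rw [Metric.infDist, dist_edist, ENNReal.toReal_eq_toReal_iff' (edist_ne_top _ _) hfin]
  have hlt : Metric.infEDist x X < t := by
    refine lt_trans ?_ hrt
    rw [← ENNReal.ofReal_toReal hfin]
    exact (ENNReal.ofReal_lt_ofReal_iff hr0).2 hx
  simpa only [key] using ht x hlt

theorem exists_inner_le_of_reach_pos (h : 0 < reach X) :
    ∃ K : ℝ, ∀ x ∈ X, ∀ n ∈ polarCone (posTangentConeAt X x), ‖n‖ = 1 → ∀ y ∈ X,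
      ⟪y - x, n⟫ ≤ K * ‖y - x‖ ^ 2 := by
  rcases X.eq_empty_or_nonempty with rfl | hne
  · exact ⟨0, by simp⟩
  obtain ⟨r, hr, hX⟩ := exists_hasUniqueProj_of_reach_pos h hne
  refine ⟨r⁻¹, fun x hx n hn hn1 y hy => ?_⟩
  rw [inv_mul_eq_div]
  exact hX.inner_le_of_polar hr hx hn1 hn hy

/-- Up to a global sign, unit normals of `X` are proximal normals of `X` or of its complement, with
a uniform radius. -/
theorem exists_inner_le_of_mem_normalBundle (hX : 0 < reach X ∨ IsComplementaryRegular X) :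
    ∃ σ K : ℝ, σ ≠ 0 ∧ ∀ p ∈ normalBundle X, ∀ q ∈ normalBundle X,
      σ * ⟪q.1 - p.1, p.2⟫ ≤ K * ‖q.1 - p.1‖ ^ 2 := by
  -- The split follows the definition of `normalCone`. In the second case normals are opposite to
  -- those of the complement set, whence `σ = -1`; frontier points belong to that set too.
  by_cases hr : 0 < reach X
  · obtain ⟨K, hK⟩ := exists_inner_le_of_reach_pos hr
    have hcl : IsClosed X := by
      rcases X.eq_empty_or_nonempty with rfl | hne
      · exact isClosed_empty
      · obtain ⟨r, hr0, hU⟩ := exists_hasUniqueProj_of_reach_pos hr hne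
        exact hU.isClosed hr0 hne
    refine ⟨1, K, one_ne_zero, fun p hp q hq => ?_⟩
    have hn := hp.2.1
    rw [normalCone, if_pos hr] at hn
    rw [one_mul]
    exact hK _ (hcl.frontier_subset hp.1) _ hn hp.2.2 _ (hcl.frontier_subset hq.1)
  · obtain ⟨K, hK⟩ := exists_inner_le_of_reach_pos (hX.resolve_left hr).reach_compl_pos
    have hsub : frontier X ⊆ complSet X := by
      rw [← frontier_compl]
      exact frontier_subset_closure
    refine ⟨-1, K, by norm_num, fun p hp q hq => ?_⟩
    have hn := hp.2.1
    rw [normalCone, if_neg hr, if_neg hp.1.2] at hn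
    have := hK _ (hsub hp.1) _ hn (by rw [norm_neg]; exact hp.2.2) _ (hsub hq.1)
    rw [inner_neg_right] at this
    rwa [neg_one_mul]

theorem smul_mem_polarCone {B : Set (E d)} {n : E d} (hn : n ∈ polarCone B) {c : ℝ} (hc : 0 ≤ c) :
    c • n ∈ polarCone B := fun b hb => by
  rw [real_inner_smul_left]
  exact mul_nonpos_of_nonneg_of_nonpos hc (hn b hb)

theorem smul_mem_normalCone {x n : E d} (hn : n ∈ normalCone X x) {c : ℝ} (hc : 0 ≤ c) :
    c • n ∈ normalCone X x := by
  unfold normalCone at hn ⊢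
  split_ifs at hn ⊢
  · exact smul_mem_polarCone hn hc
  · rw [mem_singleton_iff] at hn ⊢
    rw [hn, smul_zero]
  · rw [Set.mem_neg] at hn ⊢
    rw [← smul_neg]
    exact smul_mem_polarCone hn hc

/-- At an interior point every vector is tangent, so a polar vector `n` satisfies `⟪n, n⟫ ≤ 0`. -/
theorem eq_zero_of_mem_normalCone_of_mem_interior {x n : E d} (hx : x ∈ interior X)
    (hn : n ∈ normalCone X x) : n = 0 := by
  unfold normalCone at hn
  split_ifs at hn
  · have := hn n (by
      rw [posTangentConeAt, tangentConeAt_of_mem_nhds (mem_interior_iff_mem_nhds.1 hx)]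
      exact mem_univ n)
    rw [real_inner_self_eq_norm_sq] at this
    exact norm_eq_zero.1 (pow_eq_zero_iff two_ne_zero |>.1 (le_antisymm this (sq_nonneg _)))
  · exact hn

theorem IsCriticalPoint.mem_normalBundle {f : E d → ℝ} {x : E d} (h : IsCriticalPoint f X x)
    (h0 : gradient f x ≠ 0) : (x, unitNormal f x) ∈ normalBundle X := by
  obtain ⟨hx, hg⟩ := h
  rw [Set.mem_neg] at hg
  refine ⟨⟨subset_closure hx, fun hi => h0 ?_⟩, ?_, ?_⟩
  · exact neg_eq_zero.1 (eq_zero_of_mem_normalCone_of_mem_interior hi hg)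
  · rw [unitNormal, ← smul_neg]
    exact smul_mem_normalCone hg (inv_nonneg.2 (norm_nonneg _))
  · rw [unitNormal, norm_neg, norm_smul, norm_inv, norm_norm,
      inv_mul_cancel₀ (norm_ne_zero_iff.2 h0)]

end NormalBundle

/-! ### Tangent cones of sets of pairs with a quadratic one-sided bound -/

section Tangent

variable {V : Type*} [NormedAddCommGroup V] [InnerProductSpace ℝ V] {N : Set (V × V)} {p : V × V}
  {σ K : ℝ}

/-- The right side is of second order: after rescaling by `c` it is `K ‖c e‖ ‖e‖`, which tends to
`0`. -/
theorem inner_nonpos_of_mem_posTangentConeAt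
    (hN : ∀ q ∈ N, σ * ⟪q.1 - p.1, p.2⟫ ≤ K * ‖q.1 - p.1‖ ^ 2) {w : V × V}
    (hw : w ∈ posTangentConeAt N p) : σ * ⟪w.1, p.2⟫ ≤ 0 := by
  obtain ⟨α, l, hl, c, e, he, hmem, hlim⟩ := exists_fun_of_mem_tangentConeAt hw
  have h1 : Tendsto (fun i => c i • (e i).1) l (𝓝 w.1) := (continuous_fst.tendsto w).comp hlim
  have h2 : Tendsto (fun i => (e i).1) l (𝓝 0) := (continuous_fst.tendsto (0 : V × V)).comp he
  have hL : Tendsto (fun i => σ * ⟪c i • (e i).1, p.2⟫) l (𝓝 (σ * ⟪w.1, p.2⟫)) :=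
    (h1.inner tendsto_const_nhds).const_mul σ
  have hR : Tendsto (fun i => K * (‖c i • (e i).1‖ * ‖(e i).1‖)) l (𝓝 0) := by
    simpa using (h1.norm.mul h2.norm).const_mul K
  refine le_of_tendsto_of_tendsto hL hR (hmem.mono fun i hi => ?_)
  have h3 := hN _ hi
  simp only [Prod.fst_add, add_sub_cancel_left] at h3
  have h4 := mul_le_mul_of_nonneg_left h3 (c i).coe_nonneg
  simp only [NNReal.smul_def, real_inner_smul_left, norm_smul,
    Real.norm_of_nonneg (c i).coe_nonneg]
  linarith

/-- Adding the bound from `p` to `p + e` and the one from `p + e` to `p` cancels the terms in the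
normal of `p`. What remains is homogeneous of degree two in `e`, so it survives rescaling by `c²`.
-/
theorem neg_inner_le_of_mem_posTangentConeAt (hp : p ∈ N)
    (hN : ∀ p ∈ N, ∀ q ∈ N, σ * ⟪q.1 - p.1, p.2⟫ ≤ K * ‖q.1 - p.1‖ ^ 2) {w : V × V}
    (hw : w ∈ posTangentConeAt N p) : -(σ * ⟪w.1, w.2⟫) ≤ 2 * K * ‖w.1‖ ^ 2 := by
  obtain ⟨α, l, hl, c, e, he, hmem, hlim⟩ := exists_fun_of_mem_tangentConeAt hw
  have h1 : Tendsto (fun i => c i • (e i).1) l (𝓝 w.1) := (continuous_fst.tendsto w).comp hlim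
  have h2 : Tendsto (fun i => c i • (e i).2) l (𝓝 w.2) := (continuous_snd.tendsto w).comp hlim
  have hL : Tendsto (fun i => -(σ * ⟪c i • (e i).1, c i • (e i).2⟫)) l
      (𝓝 (-(σ * ⟪w.1, w.2⟫))) := ((h1.inner h2).const_mul σ).neg
  have hR : Tendsto (fun i => 2 * K * ‖c i • (e i).1‖ ^ 2) l (𝓝 (2 * K * ‖w.1‖ ^ 2)) :=
    (h1.norm.pow 2).const_mul _
  refine le_of_tendsto_of_tendsto hL hR (hmem.mono fun i hi => ?_)
  have h3 := hN _ hp _ hi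
  have h4 := hN _ hi _ hp
  simp only [Prod.fst_add, Prod.snd_add, add_sub_cancel_left, sub_add_cancel_left, norm_neg,
    inner_neg_left, inner_add_right] at h3 h4
  have h5 : -(σ * ⟪(e i).1, (e i).2⟫) ≤ 2 * K * ‖(e i).1‖ ^ 2 := by linarith
  have h6 := mul_le_mul_of_nonneg_left h5 (sq_nonneg (c i : ℝ))
  simp only [NNReal.smul_def, real_inner_smul_left, real_inner_smul_right, norm_smul,
    Real.norm_of_nonneg (c i).coe_nonneg]
  linarith

/-- A linear function on `ℝ` that is bounded above vanishes. -/
theorem eq_zero_of_forall_mul_le {a b : ℝ} (h : ∀ t : ℝ, t * a ≤ b) : a = 0 := by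
  by_contra ha
  have := h ((b + 1) / a)
  rw [div_mul_cancel₀ _ ha] at this
  linarith

variable {T : Submodule ℝ (V × V)}

theorem inner_eq_zero_of_posTangentConeAt_eq (hσ : σ ≠ 0) (hp : p ∈ N)
    (hN : ∀ p ∈ N, ∀ q ∈ N, σ * ⟪q.1 - p.1, p.2⟫ ≤ K * ‖q.1 - p.1‖ ^ 2)
    (hT : (T : Set (V × V)) = posTangentConeAt N p) {w : V × V} (hw : w ∈ T) :
    ⟪w.1, p.2⟫ = 0 := by
  have key : ∀ w ∈ T, σ * ⟪w.1, p.2⟫ ≤ 0 := fun w hw =>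
    inner_nonpos_of_mem_posTangentConeAt (hN p hp) (hT ▸ hw)
  have h1 := key w hw
  have h2 := key (-w) (T.neg_mem hw)
  rw [Prod.fst_neg, inner_neg_left] at h2
  exact (mul_eq_zero.1 (le_antisymm h1 (by linarith))).resolve_left hσ

/-- Adding `t (0, w)` to `(u, v)` leaves the base component `u` fixed, so the previous quadratic
bound controls a function linear in `t`, whose slope must vanish. -/
theorem inner_vertical_eq_zero_of_posTangentConeAt_eq (hσ : σ ≠ 0) (hp : p ∈ N)
    (hN : ∀ p ∈ N, ∀ q ∈ N, σ * ⟪q.1 - p.1, p.2⟫ ≤ K * ‖q.1 - p.1‖ ^ 2)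
    (hT : (T : Set (V × V)) = posTangentConeAt N p) {u v w : V} (huv : (u, v) ∈ T)
    (hw : ((0 : V), w) ∈ T) : ⟪u, w⟫ = 0 := by
  have key : ∀ t : ℝ, t * (-(σ * ⟪u, w⟫)) ≤ 2 * K * ‖u‖ ^ 2 + σ * ⟪u, v⟫ := fun t => by
    have hmem : ((u, v) + t • ((0 : V), w)) ∈ posTangentConeAt N p :=
      hT ▸ T.add_mem huv (T.smul_mem t hw)
    have := neg_inner_le_of_mem_posTangentConeAt hp hN hmem
    simp only [Prod.fst_add, Prod.snd_add, Prod.smul_fst, Prod.smul_snd, smul_zero, add_zero,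
      inner_add_right, real_inner_smul_right] at this
    linarith
  exact (mul_eq_zero.1 (neg_eq_zero.1 (eq_zero_of_forall_mul_le key))).resolve_left hσ

end Tangent

/-! ### The unit normal field of a function -/

section UnitNormal

variable {d : ℕ} {f : E d → ℝ}

theorem exists_hasFDerivAt_gradient (hf : ContDiff ℝ 2 f) (x : E d) :
    ∃ G : E d →L[ℝ] E d, HasFDerivAt (gradient f) G x ∧ ∀ u v, ⟪u, G v⟫ = hessian f x u v := by
  have hd : DifferentiableAt ℝ (fderiv ℝ f) x :=
    ((hf.fderiv_right (m := 1) (by norm_num)).differentiable (by norm_num)) x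
  -- The Riesz isomorphism is typed as conjugate-linear; over `ℝ` it is linear, and `J` records it
  -- as such.
  let J : StrongDual ℝ (E d) →L[ℝ] E d :=
    { toFun := (InnerProductSpace.toDual ℝ (E d)).symm
      map_add' := map_add _
      map_smul' := fun c v => by simp
      cont := (InnerProductSpace.toDual ℝ (E d)).symm.continuous }
  refine ⟨J.comp (fderiv ℝ (fderiv ℝ f) x), J.hasFDerivAt.comp x hd.hasFDerivAt, fun u v => ?_⟩
  have hsymm : IsSymmSndFDerivAt ℝ f x := hf.contDiffAt.isSymmSndFDerivAt (by simp)
  rw [real_inner_comm]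
  change ⟪(InnerProductSpace.toDual ℝ (E d)).symm (fderiv ℝ (fderiv ℝ f) x v), u⟫ = _
  rw [InnerProductSpace.toDual_symm_apply]
  exact hsymm.eq v u

/-- Differentiating the factor `‖∇f‖⁻¹` only contributes a multiple of `∇f`, which is invisible to
vectors `u` orthogonal to the normal. -/
theorem exists_hasFDerivAt_unitNormal (hf : ContDiff ℝ 2 f) {x : E d} (h0 : gradient f x ≠ 0) :
    ∃ D : E d →L[ℝ] E d, HasFDerivAt (unitNormal f) D x ∧
      ∀ u v, ⟪u, unitNormal f x⟫ = 0 → ‖gradient f x‖ * ⟪u, D v⟫ = -hessian f x u v := by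
  obtain ⟨G, hG, hGh⟩ := exists_hasFDerivAt_gradient hf x
  have hc : DifferentiableAt ℝ (fun y => ‖gradient f y‖⁻¹) x :=
    (hG.differentiableAt.norm ℝ h0).inv (norm_ne_zero_iff.2 h0)
  have hn := norm_ne_zero_iff.2 h0
  refine ⟨_, (hc.hasFDerivAt.smul hG).neg, fun u v hu => ?_⟩
  have hu' : ⟪u, gradient f x⟫ = 0 := by
    rw [unitNormal, inner_neg_right, real_inner_smul_right, neg_eq_zero] at hu
    exact (mul_eq_zero.1 hu).resolve_left (inv_ne_zero hn)
  simp only [neg_apply, add_apply,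
    smul_apply, ContinuousLinearMap.smulRight_apply, inner_neg_right,
    inner_add_right, real_inner_smul_right, hu', hGh, mul_zero, add_zero, mul_neg]
  rw [mul_inv_cancel_left₀ hn]

theorem continuous_gradient (hf : ContDiff ℝ 2 f) : Continuous (gradient f) :=
  (InnerProductSpace.toDual ℝ (E d)).symm.continuous.comp (hf.continuous_fderiv (by norm_num))

end UnitNormal

/-- At an accumulation point of a set `S` of a finite-dimensional space, a map that is differentiable
and sends `S` into `N` has a tangent direction of `N` in the image of a nonzero vector. -/
theorem exists_ne_zero_map_mem_posTangentConeAt {V W : Type*} [NormedAddCommGroup V]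
    [NormedSpace ℝ V] [ProperSpace V] [NormedAddCommGroup W] [NormedSpace ℝ W] {F : V → W}
    {F' : V →L[ℝ] W} {S : Set V} {N : Set W} {x : V} (hF : HasFDerivAt F F' x)
    (hS : MapsTo F S N) (hx : AccPt x (𝓟 S)) :
    ∃ u, u ≠ 0 ∧ F' u ∈ posTangentConeAt N (F x) := by
  obtain ⟨u, hu, hu0⟩ := tangentConeAt_nonempty_of_properSpace (𝕜 := ℝ) hx
  have hu0 : u ≠ 0 := hu0
  obtain ⟨α, l₀, hl₀, c, e, he, hmem, hlim⟩ := exists_fun_of_mem_tangentConeAt hu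
  -- The real tangent cone allows scalars `c i` of either sign. Along an ultrafilter one sign
  -- prevails, and if it is negative `u` is replaced by `-u`.
  let l : Ultrafilter α := Ultrafilter.of l₀
  have hl : (l : Filter α) ≤ l₀ := Ultrafilter.of_le _
  have key : ∀ (b : α → ℝ) (v : V), (∀ᶠ i in (l : Filter α), 0 ≤ b i) →
      Tendsto (fun i => b i • e i) l (𝓝 v) → F' v ∈ posTangentConeAt N (F x) := by
    intro b v hb hbv
    have he' : Tendsto (fun i => F (x + e i) - F x) l (𝓝 0) := by
      have h1 : Tendsto (fun i => x + e i) l (𝓝 x) := by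
        simpa using (tendsto_const_nhds (x := x)).add (he.mono_left hl)
      have h2 := (hF.continuousAt.tendsto.comp h1).sub_const (F x)
      rwa [sub_self] at h2
    have hder := (hF.hasFDerivWithinAt (s := univ)).lim (he.mono_left hl)
      (Eventually.of_forall fun _ => mem_univ _) hbv
    refine mem_tangentConeAt_of_seq (l : Filter α) (fun i => (b i).toNNReal) _ he' ?_
      (hder.congr' ?_)
    · filter_upwards [hl hmem] with i hi
      rw [add_sub_cancel]
      exact hS hi
    · filter_upwards [hb] with i hi
      rw [NNReal.smul_def, Real.coe_toNNReal _ hi]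
  rcases l.eventually_or.1 (Eventually.of_forall fun i => le_total 0 (c i)) with h | h
  · exact ⟨u, hu0, key c u h (hlim.mono_left hl)⟩
  · refine ⟨-u, neg_ne_zero.2 hu0, key (fun i => -c i) (-u) (h.mono fun i hi => neg_nonneg.2 hi) ?_⟩
    simpa only [neg_smul] using (hlim.mono_left hl).neg

end MorseReach

theorem mainTheorem9 (d : ℕ) (X : Set (MorseReach.E d))
    (hX : 0 < MorseReach.reach X ∨ MorseReach.IsComplementaryRegular X)
    (f : MorseReach.E d → ℝ) (hf : ContDiff ℝ 2 f) (x : MorseReach.E d)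
    (hx : MorseReach.IsNondegenerateCriticalPoint f X x) :
    ∃ U ∈ 𝓝 x, U ∩ {y | MorseReach.IsCriticalPoint f X y} = {x} := by
  open MorseReach RealInnerProductSpace in
  set S : Set (E d) := {y | IsCriticalPoint f X y ∧ gradient f y ≠ 0}
  have hxS : ¬AccPt x (𝓟 S) := by
    intro hacc
    obtain ⟨σ, K, hσ, hN⟩ := exists_inner_le_of_mem_normalBundle hX
    obtain ⟨D, hD, hDh⟩ := exists_hasFDerivAt_unitNormal hf hx.gradient_ne_zero
    have hreg := hx.isRegularPair
    obtain ⟨u, hu0, hu⟩ := exists_ne_zero_map_mem_posTangentConeAt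
      ((hasFDerivAt_id x).prodMk hD) (N := normalBundle X) (S := S)
      (fun y hy => hy.1.mem_normalBundle hy.2) hacc
    have huT : (u, D u) ∈ bundleTangent X (x, unitNormal f x) := by
      rw [← SetLike.mem_coe, hreg.coe_eq]; exact hu
    have hub : u ∈ baseSpace (bundleTangent X (x, unitNormal f x)) := ⟨_, huT, rfl⟩
    -- Nondegeneracy is used as separation on the right: it suffices that the form vanishes at `(u',
    -- u)` for all `u'`.
    refine hu0 (congrArg Subtype.val (hx.nondegenerate.2 ⟨u, hub⟩ fun u' => ?_))
    obtain ⟨⟨_, v'⟩, hv', hu'⟩ := u'.2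
    have hperp : ⟪(u' : E d), unitNormal f x⟫ = 0 := by
      rw [← hu']
      exact inner_eq_zero_of_posTangentConeAt_eq hσ hreg.mem hN hreg.coe_eq hv'
    have hII : secondFundamentalForm X (x, unitNormal f x) u' ⟨u, hub⟩ = ⟪(u' : E d), D u⟫ := by
      refine pairingForm_apply _ (fun w hw u₁ hu₁ => ?_) _ _ _ huT
      obtain ⟨⟨_, v₁⟩, hv₁, rfl⟩ := hu₁
      exact inner_vertical_eq_zero_of_posTangentConeAt_eq hσ hreg.mem hN hreg.coe_eq hv₁ hw
    have hsum : restrictedHessian f X x u' ⟨u, hub⟩ = hessian f x u' u +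
        ‖gradient f x‖ * secondFundamentalForm X (x, unitNormal f x) u' ⟨u, hub⟩ := rfl
    rw [hsum, hII, hDh _ _ hperp, add_neg_cancel]
  rw [accPt_iff_frequently, not_frequently] at hxS
  have hgrad : ∀ᶠ y in 𝓝 x, gradient f y ≠ 0 :=
    (continuous_gradient hf).continuousAt.eventually_ne hx.gradient_ne_zero
  refine ⟨_, hxS.and hgrad, ?_⟩
  ext y
  simp only [mem_inter_iff, mem_ofPred_eq, mem_singleton_iff]
  constructor
  · rintro ⟨⟨h1, h2⟩, h3⟩
    by_contra hne
    exact h1 ⟨hne, h3, h2⟩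
  · rintro rfl
    exact ⟨⟨fun h => h.1 rfl, hx.gradient_ne_zero⟩, hx.isCriticalPoint⟩
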